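/- Let $F:[0,\infty)\to(0,\infty)$ be a $C^\infty$ function such that $1/F$ is completely monotonic, that is, $(-1)^k(1/F)^{(k)}(x)\ge 0$ for all $x>0$ and all integers $k\ge 0$. Let $\varphi(z)=\sum_{n=0}^\infty\widehat\varphi(n)z^n$ be analytic in the unit disc $\mathbb D$, let $a\in(0,\infty)$, and suppose that $F(a+2n+1)=\sum_{j=0}^n\widehat\varphi(j)$ for all integers $n\ge 0$. Then there exists a finite positive Borel measure $\omega$ on $[0,1]$ whose moments $\omega_n=\int_0^1 r^n\,d\omega(r)$ satisfy $\omega_{2k+1}>0$ for all integers $k\ge0$ and $$\frac{\varphi(z)}{1-z}=\sum_{k=0}^\infty\frac{z^k}{2\omega_{2k+1}},\qquad z\in\mathbb D,$$ and which has the following additional property. If moreover $\lim_{n\to\infty}F(a+2n+1)=\infty$, there is a constant $C>0$ with $F(a+2n)\le C\,F(a+n)$ for all integers $n\ge 0$, and there is a constant $M>1$ with $\lim_{n\to\infty}M^n/F(a+n)=\infty$, then: (i) $\omega\in\widehat{\mathcal D}$, that is, $\omega$ is a measure on $[0,1)$ (so $\omega(\{1\})=0$) and there is a constant $C'>0$ with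 $\omega([r,1))\le C'\,\omega([\frac{1+r}{2},1))$ for all $0\le r<1$; (ii) $\displaystyle\frac{\varphi(\bar z\zeta)}{1-\bar z\zeta}=B^\omega_z(\zeta)$ for all $z,\zeta\in\mathbb D$, where $B^\omega_z$ is the Bergman reproducing kernel: the unique element of the space $A^2_\omega$ such that $f(z)=\int_{\mathbb D}f\,\overline{B^\omega_z}\,dA_\omega$ for all $f\in A^2_\omega$. Here $dA_\omega(re^{i\theta})=\frac1\pi\,r\,d\omega(r)\,d\theta$, and $A^2_\omega$ is the space of analytic functions $f$ in $\mathbb D$ with $\int_{\mathbb D}|f|^2\,dA_\omega<\infty$. -/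

import Mathlib

open scoped ComplexConjugate

noncomputable section

namespace RadialBergman

open MeasureTheory

/-- A function is completely monotonic on `[0, ∞)`: it is smooth on `(0, ∞)` and
`(-1)^k f^(k)(x) ≥ 0` for all `x > 0` and all `k ≥ 0`. -/
def CompletelyMonotonic (f : ℝ → ℝ) : Prop :=
  ContDiffOn ℝ (⊤ : ℕ∞) f (Set.Ioi 0) ∧
    ∀ k : ℕ, ∀ x : ℝ, 0 < x → 0 ≤ (-1 : ℝ) ^ k * iteratedDeriv k f x

/-- The moment `ω_n = ∫_0^1 r^n dω(r)` of a measure on `[0, 1]`. -/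
def radialMoment (ω : Measure ℝ) (n : ℕ) : ℝ :=
  ∫ r in Set.Icc (0 : ℝ) 1, r ^ n ∂ω

/-- The class of doubling measures: finite positive Borel measures `ω` on `[0, 1)` such that,
for some constant `C > 0`, `ω([r, 1)) ≤ C ω([(1 + r) / 2, 1))` for all `r ∈ [0, 1)`. -/
structure IsDoubling (ω : Measure ℝ) : Prop where
  finite : IsFiniteMeasure ω
  supported : ω (Set.Ico (0 : ℝ) 1)ᶜ = 0
  doubling : ∃ C : ℝ, 0 < C ∧ ∀ r : ℝ, 0 ≤ r → r < 1 →
    ω.real (Set.Ico r 1) ≤ C * ω.real (Set.Ico ((1 + r) / 2) 1)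

/-- The rotation invariant measure `r dω(r) dθ / π` in the plane, written in polar coordinates.
It is the normalized area measure `dx dy / π` of the unit disc if `ω` is the Lebesgue measure
of `[0, 1)`, and the square norm of `z^n` with respect to it is `2 ω_{2n+1}`. -/
def polarMeasure (ω : Measure ℝ) : Measure ℂ :=
  ((ω.withDensity fun r => ENNReal.ofReal r).prod
      (ENNReal.ofReal (Real.pi⁻¹) •
        (volume : Measure ℝ).restrict (Set.Ioc (-Real.pi) Real.pi))).map
    fun p : ℝ × ℝ => (p.1 : ℂ) * Complex.exp ((p.2 : ℂ) * Complex.I)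

/-- Membership in the weighted Bergman space `A²_ω`: `f` is analytic in the unit disc and
square integrable over the disc with respect to `polarMeasure ω`. Only the values of `f` in the
disc matter. -/
def MemBergmanTwo (ω : Measure ℝ) (f : ℂ → ℂ) : Prop :=
  AnalyticOnNhd ℂ f (Metric.ball 0 1) ∧
    ∫⁻ ζ in Metric.ball (0 : ℂ) 1, ‖f ζ‖ₑ ^ 2 ∂(polarMeasure ω) < ⊤

/-- `K` lies in `A²_ω` and represents the evaluation at `z`:
`f(z) = ∫ f(ζ) conj (K(ζ)) dA_ω(ζ)` for all `f` in `A²_ω`. -/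
def ReproducesAt (ω : Measure ℝ) (z : ℂ) (K : ℂ → ℂ) : Prop :=
  MemBergmanTwo ω K ∧
    ∀ f : ℂ → ℂ, MemBergmanTwo ω f →
      f z = ∫ ζ in Metric.ball (0 : ℂ) 1, f ζ * conj (K ζ) ∂(polarMeasure ω)

/-- `B` is the Bergman reproducing kernel of `A²_ω`, with `B z` for the kernel at `z`: for each
`z` in the unit disc, `B z` is the unique element of `A²_ω` that represents the evaluation
at `z`. -/
def IsBergmanKernel (ω : Measure ℝ) (B : ℂ → ℂ → ℂ) : Prop :=
  ∀ z ∈ Metric.ball (0 : ℂ) 1,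
    ReproducesAt ω z (B z) ∧
      ∀ K : ℂ → ℂ, ReproducesAt ω z K → Set.EqOn K (B z) (Metric.ball 0 1)

end RadialBergman

end

/-! Sampling a completely monotonic function at `a + n` gives a sequence whose alternating
differences are all nonnegative. Hausdorff's moment theorem therefore produces a measure `ω` with
`ω_n = 1 / (2 F(a + n))`. The partial sums of `φhat` are then exactly `1 / (2 ω_{2k+1})`, and
division of `φ` by `1 - z` turns coefficients into partial sums, which gives the series.

In `A²_ω` the monomials are orthogonal with square norms `2 ω_{2k+1}`, so the kernel is this same
series evaluated at `conj z * ζ` (`isBergmanKernel_of_hasSum`).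

For the doubling property, `F → ∞` makes the moments tend to `0`, so `ω` has no atom at `1`, and the
growth bound on `F` reads `ω_n ≤ C ω_{2n}`. Moments of order `n ~ 1 / (1 - r)` are comparable to
tail masses near `r`, so this bound becomes a comparison of tails (`isDoubling_of_radialMoment_le`).
-/

open Polynomial in
/-- The linear functional on polynomials with `X ^ n ↦ s n`. -/
noncomputable def momentFunctional (s : ℕ → ℝ) : ℝ[X] →ₗ[ℝ] ℝ :=
  Polynomial.lsum fun n => s n • LinearMap.id

/-- The iterated differences `(-1)^j (Δ^j s)(n)`. -/
def altDiff (s : ℕ → ℝ) : ℕ → ℕ → ℝ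
  | 0, n => s n
  | j + 1, n => altDiff s j n - altDiff s j (n + 1)

/-! ### The Hausdorff moment problem, by Bernstein weights and compactness. -/

section Hausdorff
open MeasureTheory Filter Topology Polynomial

lemma momentFunctional_X_pow (s : ℕ → ℝ) (n : ℕ) : momentFunctional s (X ^ n) = s n := by
  simp [momentFunctional, Polynomial.lsum_apply, ← Polynomial.monomial_one_right_eq_X_pow]

/-- Under the functional, multiplication by `1 - X` is the difference operator. Nonnegative
differences thus mean positivity on Bernstein polynomials. -/
lemma momentFunctional_X_pow_mul (s : ℕ → ℝ) (j n : ℕ) :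
    momentFunctional s (X ^ n * (1 - X) ^ j) = altDiff s j n := by
  induction j generalizing n with
  | zero => simp [altDiff, momentFunctional_X_pow]
  | succ j ih =>
    have : (X ^ n * (1 - X) ^ (j + 1) : ℝ[X])
        = X ^ n * (1 - X) ^ j - X ^ (n + 1) * (1 - X) ^ j := by ring
    rw [this, map_sub, ih, ih, altDiff]

lemma momentFunctional_bernsteinPolynomial (s : ℕ → ℝ) (N k : ℕ) :
    momentFunctional s (bernsteinPolynomial ℝ N k) = N.choose k * altDiff s (N - k) k := by
  have : bernsteinPolynomial ℝ N k = (N.choose k : ℝ) • (X ^ k * (1 - X) ^ (N - k)) := by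
    rw [bernsteinPolynomial, Polynomial.smul_eq_C_mul]
    simp [mul_assoc]
  rw [this, map_smul, momentFunctional_X_pow_mul, smul_eq_mul]

/-- This is the factorial moment of the binomial law: `C(N,k) C(k,m) = C(N,m) C(N-m,k-m)`, then the
binomial theorem. -/
lemma sum_choose_mul_bernsteinPolynomial (m M : ℕ) :
    ∑ k ∈ Finset.range (m + M + 1), ((k.choose m : ℝ)) • bernsteinPolynomial ℝ (m + M) k
      = (((m + M).choose m : ℝ)) • X ^ m := by
  rw [add_assoc, Finset.sum_range_add, Finset.sum_eq_zero, zero_add]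
  · have h : ∀ i ∈ Finset.range (M + 1),
        (((m + i).choose m : ℝ)) • bernsteinPolynomial ℝ (m + M) (m + i)
          = ((((m + M).choose m : ℝ)) • X ^ m) * (X ^ i * (1 - X) ^ (M - i) * (M.choose i : ℝ[X])) := by
      intro i hi
      have hi' : i ≤ M := by simpa [Nat.lt_succ_iff] using hi
      have hc := Nat.choose_mul (n := m + M) (k := m + i) (s := m) (by omega)
      simp only [Nat.add_sub_cancel_left] at hc
      have hc' : (((m + M).choose (m + i) : ℕ) : ℝ[X]) * (((m + i).choose m : ℕ) : ℝ[X])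
          = (((m + M).choose m : ℕ) : ℝ[X]) * ((M.choose i : ℕ) : ℝ[X]) := by exact_mod_cast hc
      rw [bernsteinPolynomial, Polynomial.smul_eq_C_mul, Polynomial.smul_eq_C_mul,
        Nat.add_sub_add_left, pow_add]
      simp only [map_natCast]
      linear_combination (X ^ m * X ^ i * (1 - X) ^ (M - i)) * hc'
    rw [Finset.sum_congr rfl h, ← Finset.mul_sum, ← add_pow]
    simp
  · intro k hk
    rw [Nat.choose_eq_zero_of_lt (Finset.mem_range.mp hk)]
    simp

/-- The weight at `k / N` of the `N`-th approximating measure in the Hausdorff moment problem. -/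
noncomputable def hausdorffWeight (s : ℕ → ℝ) (N k : ℕ) : ℝ :=
  N.choose k * altDiff s (N - k) k

lemma sum_choose_mul_hausdorffWeight (s : ℕ → ℝ) (m M : ℕ) :
    ∑ k ∈ Finset.range (m + M + 1), (k.choose m : ℝ) * hausdorffWeight s (m + M) k
      = (m + M).choose m * s m := by
  have := congrArg (momentFunctional s) (sum_choose_mul_bernsteinPolynomial m M)
  simpa only [map_sum, map_smul, smul_eq_mul, momentFunctional_bernsteinPolynomial,
    momentFunctional_X_pow, hausdorffWeight] using this

lemma sum_hausdorffWeight (s : ℕ → ℝ) (N : ℕ) :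
    ∑ k ∈ Finset.range (N + 1), hausdorffWeight s N k = s 0 := by
  simpa using sum_choose_mul_hausdorffWeight s 0 N

lemma sum_descFactorial_mul_hausdorffWeight (s : ℕ → ℝ) {m N : ℕ} (h : m ≤ N) :
    ∑ k ∈ Finset.range (N + 1), (k.descFactorial m / N.descFactorial m : ℝ) * hausdorffWeight s N k
      = s m := by
  obtain ⟨M, rfl⟩ := Nat.exists_eq_add_of_le h
  have h1 := sum_choose_mul_hausdorffWeight s m M
  have hpos : (0 : ℝ) < (m + M).choose m := by exact_mod_cast Nat.choose_pos h
  have hf : (0 : ℝ) < (m.factorial : ℝ) := by exact_mod_cast m.factorial_pos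
  rw [← mul_right_inj' hpos.ne', ← h1, Finset.mul_sum]
  refine Finset.sum_congr rfl fun k _ => ?_
  rw [Nat.descFactorial_eq_factorial_mul_choose, Nat.descFactorial_eq_factorial_mul_choose]
  push_cast
  field_simp

/-- The discrete weights have exact factorial moments; this bound trades them for ordinary moments.
Both sides are products of `m` factors in `[0, 1]`, and corresponding factors differ by at most `m /
(N - m)`. -/
lemma abs_pow_sub_descFactorial_div_le {m N k : ℕ} (hm : m < N) (hk : k ≤ N) :
    |((k : ℝ) / N) ^ m - (k.descFactorial m / N.descFactorial m : ℝ)| ≤ (m * m : ℝ) / (N - m) := by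
  have hN : (0 : ℝ) < N := by exact_mod_cast (Nat.zero_le m).trans_lt hm
  suffices H : ∀ j ≤ m, |((k : ℝ) / N) ^ j - (k.descFactorial j / N.descFactorial j : ℝ)|
      ≤ j * (m / (N - m) : ℝ) by
    have := H m le_rfl
    rwa [mul_div_assoc]
  have hNm : (0 : ℝ) < N - m := by
    have : (m : ℝ) < N := by exact_mod_cast hm
    linarith
  intro j
  induction j with
  | zero => simp
  | succ j ih =>
    intro hj
    have ih := ih (by omega)
    set x : ℝ := (k : ℝ) / N
    set y : ℝ := (k.descFactorial j / N.descFactorial j : ℝ)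
    have hjN : ((N - j : ℕ) : ℝ) = N - j := by rw [Nat.cast_sub (by omega)]
    have hjN0 : (0 : ℝ) < N - j := by
      rw [← hjN]; exact_mod_cast (by omega : 0 < N - j)
    set t : ℝ := ((k - j : ℕ) : ℝ) / (N - j)
    have hy : (((k.descFactorial (j + 1) : ℕ) : ℝ) / ((N.descFactorial (j + 1) : ℕ) : ℝ)) = t * y := by
      rw [Nat.descFactorial_succ, Nat.descFactorial_succ]
      push_cast
      rw [hjN]
      simp only [t, y]
      rw [div_mul_div_comm]
    have hx0 : 0 ≤ x := by positivity
    have hx1 : x ≤ 1 := by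
      rw [div_le_one hN]; exact_mod_cast hk
    have hy0 : 0 ≤ y := by positivity
    have hy1 : y ≤ 1 := by
      apply div_le_one_of_le₀ _ (by positivity)
      exact_mod_cast Nat.descFactorial_le _ hk
    have hjm : (j : ℝ) ≤ m := by exact_mod_cast (by omega : j ≤ m)
    have hxt : |x - t| ≤ m / (N - m) := by
      have hmN : (m : ℝ) / N ≤ m / (N - m) := by
        apply div_le_div_of_nonneg_left (by positivity) hNm
        have : (0 : ℝ) ≤ m := by positivity
        linarith
      rcases le_total j k with h | h
      · have hkj : ((k - j : ℕ) : ℝ) = k - j := by rw [Nat.cast_sub h]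
        have hkN : (k : ℝ) ≤ N := by exact_mod_cast hk
        have e : x - t = (j / (N - j)) * ((N - k) / N) := by
          simp only [x, t, hkj]
          field_simp
          ring
        have h2 : ((N : ℝ) - k) / N ≤ 1 := by
          rw [div_le_one hN]
          have : (0 : ℝ) ≤ k := by positivity
          linarith
        have h3 : (0 : ℝ) ≤ ((N : ℝ) - k) / N := div_nonneg (by linarith) hN.le
        rw [e, abs_of_nonneg (by positivity)]
        calc (j / (N - j) : ℝ) * ((N - k) / N) ≤ (j / (N - j)) * 1 := by gcongr
          _ ≤ m / (N - m) := by rw [mul_one]; gcongr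
      · have ht : t = 0 := by simp [t, Nat.sub_eq_zero_of_le h]
        rw [ht, sub_zero, abs_of_nonneg hx0]
        refine le_trans ?_ hmN
        have hkm : (k : ℝ) ≤ m := le_trans (by exact_mod_cast h) hjm
        exact div_le_div_of_nonneg_right hkm hN.le
    rw [hy, pow_succ]
    have e : x ^ j * x - t * y = x * (x ^ j - y) + y * (x - t) := by ring
    rw [e]
    calc |x * (x ^ j - y) + y * (x - t)| ≤ |x * (x ^ j - y)| + |y * (x - t)| := abs_add_le _ _
      _ = x * |x ^ j - y| + y * |x - t| := by rw [abs_mul, abs_mul, abs_of_nonneg hx0, abs_of_nonneg hy0]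
      _ ≤ 1 * (j * (m / (N - m))) + 1 * (m / (N - m)) := by gcongr
      _ = ((j + 1 : ℕ) : ℝ) * (m / (N - m)) := by push_cast; ring

lemma tendsto_sum_pow_mul_hausdorffWeight {s : ℕ → ℝ} (hs : ∀ j n, 0 ≤ altDiff s j n) (m : ℕ) :
    Tendsto (fun N : ℕ => ∑ k ∈ Finset.range (N + 1), ((k : ℝ) / N) ^ m * hausdorffWeight s N k)
      atTop (𝓝 (s m)) := by
  have hw : ∀ N k, 0 ≤ hausdorffWeight s N k := fun N k =>
    mul_nonneg (by positivity) (hs _ _)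
  rw [tendsto_iff_dist_tendsto_zero]
  have hlim : Tendsto (fun N : ℕ => (m * m : ℝ) / (N - m) * s 0) atTop (𝓝 0) := by
    rw [← zero_mul (s 0)]
    refine Tendsto.mul_const _ (tendsto_const_nhds.div_atTop ?_)
    exact tendsto_atTop_add_const_right _ _ tendsto_natCast_atTop_atTop
  refine squeeze_zero' (Eventually.of_forall fun _ => dist_nonneg) ?_ hlim
  filter_upwards [eventually_gt_atTop m] with N hN
  rw [Real.dist_eq]
  conv_lhs => rw [← sum_descFactorial_mul_hausdorffWeight s hN.le]
  rw [← Finset.sum_sub_distrib, ← sum_hausdorffWeight s N, Finset.mul_sum]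
  refine (Finset.abs_sum_le_sum_abs _ _).trans (Finset.sum_le_sum fun k hk => ?_)
  rw [← sub_mul, abs_mul, abs_of_nonneg (hw N k)]
  exact mul_le_mul_of_nonneg_right
    (abs_pow_sub_descFactorial_div_le hN (by simpa [Nat.lt_succ_iff] using hk)) (hw N k)

/-- **Hausdorff moment theorem** on the unit interval. -/
theorem exists_measure_unitInterval_moments {s : ℕ → ℝ} (hs : ∀ j n, 0 ≤ altDiff s j n)
    (h0 : s 0 = 1) :
    ∃ μ : ProbabilityMeasure unitInterval, ∀ m : ℕ,
      ∫ x : unitInterval, (x : ℝ) ^ m ∂(μ : Measure unitInterval) = s m := by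
  have hw : ∀ N k, 0 ≤ hausdorffWeight s N k := fun N k =>
    mul_nonneg (by positivity) (hs _ _)
  let pt : ℕ → ℕ → unitInterval := fun N k => Set.projIcc 0 1 zero_le_one ((k : ℝ) / N)
  have hpt : ∀ N, ∀ k ∈ Finset.range (N + 1), ((pt N k : unitInterval) : ℝ) = (k : ℝ) / N := by
    intro N k hk
    have hk' : k ≤ N := by simpa [Nat.lt_succ_iff] using hk
    have : (k : ℝ) / N ∈ Set.Icc (0 : ℝ) 1 :=
      ⟨by positivity, div_le_one_of_le₀ (by exact_mod_cast hk') (by positivity)⟩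
    simp [pt, Set.projIcc_of_mem zero_le_one this]
  let P : ℕ → Measure unitInterval := fun N =>
    ∑ k ∈ Finset.range (N + 1), ENNReal.ofReal (hausdorffWeight s N k) • Measure.dirac (pt N k)
  have hP : ∀ N, IsProbabilityMeasure (P N) := fun N => ⟨by
    simp only [P, Measure.coe_finsetSum, Finset.sum_apply, Measure.smul_apply, measure_univ,
      smul_eq_mul, mul_one]
    rw [← ENNReal.ofReal_sum_of_nonneg fun k _ => hw N k, sum_hausdorffWeight, h0,
      ENNReal.ofReal_one]⟩
  let ν : ℕ → ProbabilityMeasure unitInterval := fun N => ⟨P N, hP N⟩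
  -- Compactness gives a limit along a free ultrafilter, with no subsequence to extract. Limits
  -- along `atTop` persist along it, which identifies the moments.
  let U : Ultrafilter (ProbabilityMeasure unitInterval) := (hyperfilter ℕ).map ν
  obtain ⟨μ, -, hμ⟩ := isCompact_univ.ultrafilter_le_nhds U (by simp)
  have hμ : Tendsto ν (hyperfilter ℕ : Filter ℕ) (𝓝 μ) := hμ
  refine ⟨μ, fun m => ?_⟩
  let f : BoundedContinuousFunction unitInterval ℝ :=
    BoundedContinuousFunction.mkOfCompact ⟨fun x => (x : ℝ) ^ m, by fun_prop⟩
  have h1 := (ProbabilityMeasure.tendsto_iff_forall_integral_tendsto.mp hμ) f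
  have h2 : Tendsto (fun N => ∫ x, f x ∂(ν N : Measure unitInterval)) (hyperfilter ℕ : Filter ℕ)
      (𝓝 (s m)) := by
    refine Tendsto.congr (fun N => ?_) ((tendsto_sum_pow_mul_hausdorffWeight hs m).mono_left
      Nat.hyperfilter_le_atTop)
    change _ = ∫ x, f x ∂(P N)
    rw [integral_finsetSum_measure fun k _ => (f.integrable _).smul_measure ENNReal.ofReal_ne_top]
    refine Finset.sum_congr rfl fun k hk => ?_
    rw [integral_smul_measure, integral_dirac, ENNReal.toReal_ofReal (hw N k), smul_eq_mul,
      mul_comm]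
    simp [f, hpt N k hk]
  exact tendsto_nhds_unique h1 h2

/-- **Hausdorff moment theorem**: a completely monotone sequence is the moment sequence of a
finite measure on `[0, 1]`. -/
theorem exists_measure_radialMoment {s : ℕ → ℝ} (hs : ∀ j n, 0 ≤ altDiff s j n) (h0 : 0 < s 0) :
    ∃ ω : Measure ℝ, IsFiniteMeasure ω ∧ ω (Set.Icc (0 : ℝ) 1)ᶜ = 0 ∧
      ∀ n, RadialBergman.radialMoment ω n = s n := by
  have hs' : ∀ j n, altDiff (fun n => s n / s 0) j n = altDiff s j n / s 0 := by
    intro j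
    induction j with
    | zero => intro n; rfl
    | succ j ih => intro n; simp only [altDiff, ih]; ring
  -- Normalize to total mass one, then push forward to `ℝ` and rescale.
  obtain ⟨μ, hμ⟩ := exists_measure_unitInterval_moments (s := fun n => s n / s 0)
    (fun j n => by rw [hs']; exact div_nonneg (hs j n) h0.le) (div_self h0.ne')
  let τ : Measure ℝ := (μ : Measure unitInterval).map Subtype.val
  have hτ : τ (Set.Icc (0 : ℝ) 1)ᶜ = 0 := by
    rw [Measure.map_apply measurable_subtype_coe measurableSet_Icc.compl]
    have : (Subtype.val ⁻¹' (Set.Icc (0 : ℝ) 1)ᶜ : Set unitInterval) = ∅ := by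
      ext x; simp
    rw [this, measure_empty]
  have : IsProbabilityMeasure τ := Measure.isProbabilityMeasure_map measurable_subtype_coe.aemeasurable
  refine ⟨ENNReal.ofReal (s 0) • τ, ?_, by simp [hτ], fun n => ?_⟩
  · exact Measure.smul_finite _ ENNReal.ofReal_ne_top
  · rw [RadialBergman.radialMoment, Measure.restrict_smul, integral_smul_measure,
      ENNReal.toReal_ofReal h0.le, Measure.restrict_eq_self_of_ae_mem (by
        rw [ae_iff]; exact hτ),
      integral_map measurable_subtype_coe.aemeasurable (by fun_prop), hμ, smul_eq_mul,
      mul_div_cancel₀ _ h0.ne']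

end Hausdorff

/-! ### From complete monotonicity to nonnegative differences. -/

section CompletelyMonotone

open RadialBergman

lemma RadialBergman.CompletelyMonotonic.contDiffAt {f : ℝ → ℝ} (hf : CompletelyMonotonic f) {x : ℝ}
    (hx : 0 < x) : ContDiffAt ℝ (⊤ : ℕ∞) f x :=
  hf.1.contDiffAt (Ioi_mem_nhds hx)

lemma RadialBergman.CompletelyMonotonic.differentiableAt_iteratedDeriv {f : ℝ → ℝ} (hf : CompletelyMonotonic f)
    (k : ℕ) {x : ℝ} (hx : 0 < x) : DifferentiableAt ℝ (iteratedDeriv k f) x := by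
  have h := (hf.1.differentiableOn_iteratedDerivWithin (m := k)
    (by exact_mod_cast ENat.natCast_lt_top k) isOpen_Ioi.uniqueDiffOn).differentiableAt
    (Ioi_mem_nhds hx)
  refine h.congr_of_eventuallyEq ?_
  filter_upwards [Ioi_mem_nhds hx] with y hy
  exact (iteratedDerivWithin_of_isOpen isOpen_Ioi hy).symm

lemma RadialBergman.CompletelyMonotonic.antitoneOn {f : ℝ → ℝ} (hf : CompletelyMonotonic f) (k : ℕ) :
    AntitoneOn (fun x => (-1 : ℝ) ^ k * iteratedDeriv k f x) (Set.Ioi 0) := by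
  have hd : ∀ x ∈ Set.Ioi (0 : ℝ),
      HasDerivAt (fun x => (-1 : ℝ) ^ k * iteratedDeriv k f x)
        ((-1 : ℝ) ^ k * iteratedDeriv (k + 1) f x) x := by
    intro x hx
    have := (hf.differentiableAt_iteratedDeriv k hx).hasDerivAt.const_mul ((-1 : ℝ) ^ k)
    rwa [← iteratedDeriv_succ] at this
  refine antitoneOn_of_deriv_nonpos (convex_Ioi 0)
    (fun x hx => (hd x hx).continuousAt.continuousWithinAt)
    (fun x hx => (hd x (interior_subset hx)).differentiableAt.differentiableWithinAt) ?_
  intro x hx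
  have hx' := interior_subset hx
  rw [(hd x hx').deriv]
  have := hf.2 (k + 1) x hx'
  rw [pow_succ] at this
  linarith

/-- Each `(-1)^k f^(k)` is antitone, so its decrease over a unit step is nonnegative. -/
lemma RadialBergman.CompletelyMonotonic.sub_shift {f : ℝ → ℝ} (hf : CompletelyMonotonic f) :
    CompletelyMonotonic (fun x => f x - f (x + 1)) := by
  have hshift : ∀ x : ℝ, 0 < x → ContDiffAt ℝ (⊤ : ℕ∞) (fun y => f (y + 1)) x := by
    intro x hx
    exact (hf.contDiffAt (x := x + 1) (by linarith)).comp x (by fun_prop)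
  refine ⟨fun x hx => ((hf.contDiffAt hx).sub (hshift x hx)).contDiffWithinAt, fun k x hx => ?_⟩
  have h1 : iteratedDeriv k (fun x => f x - f (x + 1)) x
      = iteratedDeriv k f x - iteratedDeriv k f (x + 1) := by
    rw [iteratedDeriv_fun_sub ((hf.contDiffAt hx).of_le (by exact_mod_cast le_top))
      ((hshift x hx).of_le (by exact_mod_cast le_top)), iteratedDeriv_comp_add_const]
  rw [h1, mul_sub]
  have := hf.antitoneOn k (show x ∈ Set.Ioi (0 : ℝ) from hx)
    (show x + 1 ∈ Set.Ioi (0 : ℝ) from by simp; linarith) (by linarith)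
  simpa using this

lemma RadialBergman.CompletelyMonotonic.altDiff_nonneg {f : ℝ → ℝ} (hf : CompletelyMonotonic f) {a : ℝ}
    (ha : 0 < a) (j n : ℕ) : 0 ≤ altDiff (fun n : ℕ => f (a + n)) j n := by
  induction j generalizing f n with
  | zero =>
    have := hf.2 0 (a + n) (by positivity)
    simpa [altDiff] using this
  | succ j ih =>
    -- The extra difference is moved inside, onto `f`, so that induction applies to `f - f(· + 1)`.
    have key : ∀ (j n : ℕ), altDiff (fun n : ℕ => f (a + n) - f (a + n + 1)) j n
        = altDiff (fun n : ℕ => f (a + n)) (j + 1) n := by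
      intro j
      induction j with
      | zero => intro n; simp [altDiff, add_assoc]
      | succ j ih' => intro n; rw [altDiff, ih', ih', ← altDiff]
    rw [← key]
    exact ih hf.sub_shift n

end CompletelyMonotone

/-! ### Doubling from moment bounds. -/

section Doubling
open MeasureTheory Filter Topology RadialBergman

lemma integrableOn_pow_Icc (ω : Measure ℝ) [IsFiniteMeasure ω] (n : ℕ) :
    IntegrableOn (fun r : ℝ => r ^ n) (Set.Icc 0 1) ω :=
  (continuous_pow n).continuousOn.integrableOn_Icc

lemma measureReal_singleton_one_le_radialMoment (ω : Measure ℝ) [IsFiniteMeasure ω] (n : ℕ) :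
    ω.real {1} ≤ radialMoment ω n := by
  have h : ∫ r in ({1} : Set ℝ), r ^ n ∂ω = ω.real {1} := by
    simp [Measure.real]
  rw [← h]
  refine setIntegral_mono_set (integrableOn_pow_Icc ω n) ?_ ?_
  · filter_upwards [ae_restrict_mem measurableSet_Icc] with r hr using pow_nonneg hr.1 n
  · exact LE.le.eventuallyLE (by simp)

lemma pow_mul_measureReal_Ico_le_radialMoment (ω : Measure ℝ) [IsFiniteMeasure ω] (n : ℕ) {ρ : ℝ}
    (hρ : 0 ≤ ρ) : ρ ^ n * ω.real (Set.Ico ρ 1) ≤ radialMoment ω n := by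
  have hsub : Set.Ico ρ 1 ⊆ Set.Icc 0 1 := fun x hx => ⟨hρ.trans hx.1, hx.2.le⟩
  have h : ∫ r in Set.Ico ρ 1, ρ ^ n ∂ω = ρ ^ n * ω.real (Set.Ico ρ 1) := by
    simp [mul_comm]
  rw [← h]
  calc ∫ r in Set.Ico ρ 1, ρ ^ n ∂ω ≤ ∫ r in Set.Ico ρ 1, r ^ n ∂ω :=
        setIntegral_mono_on (integrableOn_const (by finiteness))
          ((integrableOn_pow_Icc ω n).mono_set hsub) measurableSet_Ico
          fun r hr => pow_le_pow_left₀ hρ hr.1 n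
    _ ≤ radialMoment ω n := by
        refine setIntegral_mono_set (integrableOn_pow_Icc ω n) ?_ hsub.eventuallyLE
        filter_upwards [ae_restrict_mem measurableSet_Icc] with r hr using pow_nonneg hr.1 n

/-- Split at `ρ`: below it `r ^ l ≤ ρ ^ l`, above it `r ^ (n + l) ≤ 1`. The absence of an atom at
`1` allows the half-open tail. -/
lemma radialMoment_add_le (ω : Measure ℝ) [IsFiniteMeasure ω] (h1 : ω {1} = 0) (n l : ℕ) {ρ : ℝ}
    (hρ : 0 ≤ ρ) :
    radialMoment ω (n + l) ≤ ρ ^ l * radialMoment ω n + ω.real (Set.Ico ρ 1) := by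
  have hI : ∫ r in Set.Icc (0 : ℝ) 1, (Set.Icc ρ 1).indicator 1 r ∂ω = ω.real (Set.Ico ρ 1) := by
    rw [setIntegral_indicator measurableSet_Icc,
      Set.inter_eq_self_of_subset_right (Set.Icc_subset_Icc_left hρ)]
    simp only [Pi.one_apply, integral_const, smul_eq_mul, mul_one, Measure.real,
      Measure.restrict_apply_univ]
    congr 1
    refine measure_congr ?_
    have : ∀ᵐ x ∂ω, x ≠ 1 := by rw [ae_iff]; simpa using h1
    filter_upwards [this] with x hx
    change (x ∈ Set.Icc ρ 1) = (x ∈ Set.Ico ρ 1)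
    simp only [Set.mem_Icc, Set.mem_Ico, eq_iff_iff]
    exact ⟨fun h => ⟨h.1, lt_of_le_of_ne h.2 hx⟩, fun h => ⟨h.1, h.2.le⟩⟩
  have hint : IntegrableOn ((Set.Icc ρ 1).indicator (1 : ℝ → ℝ)) (Set.Icc 0 1) ω :=
    (integrable_const (1 : ℝ)).indicator measurableSet_Icc
  rw [radialMoment, radialMoment, ← integral_const_mul, ← hI,
    ← integral_add ((integrableOn_pow_Icc ω n).const_mul _) hint]
  refine setIntegral_mono_on (integrableOn_pow_Icc ω _)
    (((integrableOn_pow_Icc ω n).const_mul _).add hint) measurableSet_Icc fun r hr => ?_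
  have hn : 0 ≤ r ^ n := pow_nonneg hr.1 n
  rcases le_total ρ r with h | h
  · have : r ∈ Set.Icc ρ 1 := ⟨h, hr.2⟩
    rw [Set.indicator_of_mem this]
    have h2 : r ^ (n + l) ≤ 1 := pow_le_one₀ hr.1 hr.2
    have h3 : 0 ≤ ρ ^ l * r ^ n := by positivity
    simp only [Pi.one_apply]
    linarith
  · have h2 : 0 ≤ (Set.Icc ρ 1).indicator (1 : ℝ → ℝ) r :=
      Set.indicator_nonneg (fun _ _ => zero_le_one) _
    have h3 : r ^ l ≤ ρ ^ l := pow_le_pow_left₀ hr.1 h l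
    rw [pow_add, mul_comm]
    nlinarith [mul_le_mul_of_nonneg_right h3 hn]

/-- With `C < 2 ^ p`, the factor `C ^ j` is at most a power of `2 ^ j`, which the decay of `q ^ (2 ^
j)` beats. -/
lemma exists_pow_mul_pow_two_pow_le (C q : ℝ) (hC : 0 < C) (hq0 : 0 < q) (hq : q < 1) :
    ∃ j : ℕ, C ^ j * q ^ (2 ^ j - 1) ≤ 1 / 2 := by
  obtain ⟨p, hp⟩ := pow_unbounded_of_one_lt C (one_lt_two)
  have h := tendsto_pow_const_mul_const_pow_of_abs_lt_one p (r := q) (by rwa [abs_of_pos hq0])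
  have h2 := h.comp (tendsto_pow_atTop_atTop_of_one_lt (r := 2) one_lt_two)
  obtain ⟨j, hj⟩ := (h2.eventually (gt_mem_nhds (show (0 : ℝ) < q / 2 by positivity))).exists
  refine ⟨j, ?_⟩
  simp only [Function.comp_apply, Nat.cast_pow, Nat.cast_ofNat] at hj
  have h3 : C ^ j ≤ ((2 : ℝ) ^ j) ^ p := by
    rw [← pow_mul, mul_comm, pow_mul]
    exact pow_le_pow_left₀ hC.le hp.le j
  have h4 : q ^ (2 ^ j) = q ^ (2 ^ j - 1) * q := by
    rw [← pow_succ, Nat.sub_add_cancel Nat.one_le_two_pow]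
  have h5 : C ^ j * q ^ (2 ^ j - 1) * q ≤ 1 / 2 * q := by
    calc C ^ j * q ^ (2 ^ j - 1) * q = C ^ j * q ^ (2 ^ j) := by rw [h4]; ring
      _ ≤ ((2 : ℝ) ^ j) ^ p * q ^ (2 ^ j) := by gcongr
      _ ≤ 1 / 2 * q := by linarith
  exact le_of_mul_le_mul_right h5 hq0

/-- A measure on `[0, 1]` whose moments satisfy `ω_n ≤ C ω_{2n}` and tend to `0` is doubling. -/
theorem isDoubling_of_radialMoment_le {ω : Measure ℝ} [IsFiniteMeasure ω]
    (hsupp : ω (Set.Icc (0 : ℝ) 1)ᶜ = 0) (hpos : ∀ n, 0 < radialMoment ω n)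
    (h0 : Tendsto (fun k : ℕ => radialMoment ω (2 * k + 1)) atTop (𝓝 0))
    {C : ℝ} (hC : 0 < C) (hm : ∀ n, radialMoment ω n ≤ C * radialMoment ω (2 * n)) :
    IsDoubling ω := by
  have hone : ω {1} = 0 := by
    have h : ω.real {1} ≤ 0 :=
      ge_of_tendsto' h0 fun k => measureReal_singleton_one_le_radialMoment ω _
    exact (measureReal_eq_zero_iff).mp (le_antisymm h measureReal_nonneg)
  have hiter : ∀ j n, radialMoment ω n ≤ C ^ j * radialMoment ω (2 ^ j * n) := by
    intro j
    induction j with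
    | zero => intro n; simp
    | succ j ih =>
      intro n
      calc radialMoment ω n ≤ C ^ j * radialMoment ω (2 ^ j * n) := ih n
        _ ≤ C ^ j * (C * radialMoment ω (2 * (2 ^ j * n))) := by gcongr; exact hm _
        _ = C ^ (j + 1) * radialMoment ω (2 ^ (j + 1) * n) := by
          rw [pow_succ, pow_succ, mul_assoc, mul_comm (2 ^ j) 2, mul_assoc]
  -- For `n = ⌊1 / (2 (1 - r))⌋ ≥ 1` one has `n (1 - r) > 1/4`, hence `((1 + r) / 2) ^ n ≤ exp (-n
  -- (1 - r) / 2) ≤ q`.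
  set q : ℝ := Real.exp (-1 / 8)
  obtain ⟨j, hj⟩ := exists_pow_mul_pow_two_pow_le C q hC (Real.exp_pos _)
    (Real.exp_lt_one_iff.mpr (by norm_num))
  -- Compare `ω_n` with `ω_{2^j n}`: the part below `(1 + r) / 2` contributes at most `ω_n / 2`, by
  -- the choice of `j`, and is absorbed on the left.
  have key : ∀ r : ℝ, 1 / 2 ≤ r → r < 1 → ∃ n : ℕ, n * (1 - r) ≤ 1 / 2 ∧
      radialMoment ω n ≤ 2 * C ^ j * ω.real (Set.Ico ((1 + r) / 2) 1) := by
    intro r hr hr1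
    have hr' : 0 < 1 - r := by linarith
    set n : ℕ := ⌊1 / (2 * (1 - r))⌋₊
    have hx1 : 1 ≤ 1 / (2 * (1 - r)) := by
      rw [le_div_iff₀ (by linarith)]; linarith
    have hn1 : 1 ≤ n := (Nat.one_le_floor_iff _).mpr hx1
    have hn1' : (1 : ℝ) ≤ n := by exact_mod_cast hn1
    have hle : (n : ℝ) ≤ 1 / (2 * (1 - r)) := Nat.floor_le (by positivity)
    have hlt : 1 / (2 * (1 - r)) < n + 1 := Nat.lt_floor_add_one _
    rw [le_div_iff₀ (by linarith)] at hle
    rw [div_lt_iff₀ (by linarith)] at hlt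
    refine ⟨n, by linarith, ?_⟩
    set ρ : ℝ := (1 + r) / 2
    have hρ0 : 0 ≤ ρ := by simp only [ρ]; linarith
    have hρq : ρ ^ n ≤ q := by
      have h1 : ρ ≤ Real.exp (-(1 - r) / 2) := by
        have := Real.add_one_le_exp (-(1 - r) / 2)
        simp only [ρ]; linarith
      calc ρ ^ n ≤ Real.exp (-(1 - r) / 2) ^ n := pow_le_pow_left₀ hρ0 h1 n
        _ = Real.exp (n * (-(1 - r) / 2)) := by rw [← Real.exp_nat_mul]
        _ ≤ q := Real.exp_le_exp.mpr (by nlinarith)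
    have h2 := radialMoment_add_le ω hone n ((2 ^ j - 1) * n) hρ0
    have e : n + (2 ^ j - 1) * n = 2 ^ j * n := by
      obtain ⟨t, ht⟩ := Nat.exists_eq_add_of_le (Nat.one_le_two_pow (n := j))
      rw [ht]; simp; ring
    rw [e] at h2
    have h3 : ρ ^ ((2 ^ j - 1) * n) ≤ q ^ (2 ^ j - 1) := by
      rw [mul_comm, pow_mul]
      exact pow_le_pow_left₀ (by positivity) hρq _
    have hW : 0 ≤ ω.real (Set.Ico ρ 1) := measureReal_nonneg
    have hCj : 0 < C ^ j := pow_pos hC j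
    have h4 : radialMoment ω n
        ≤ C ^ j * q ^ (2 ^ j - 1) * radialMoment ω n + C ^ j * ω.real (Set.Ico ρ 1) := by
      calc radialMoment ω n ≤ C ^ j * radialMoment ω (2 ^ j * n) := hiter j n
        _ ≤ C ^ j * (ρ ^ ((2 ^ j - 1) * n) * radialMoment ω n + ω.real (Set.Ico ρ 1)) := by gcongr
        _ ≤ C ^ j * (q ^ (2 ^ j - 1) * radialMoment ω n + ω.real (Set.Ico ρ 1)) := by
          have := (hpos n).le
          gcongr
        _ = _ := by ring
    have h5 := mul_le_mul_of_nonneg_right hj (hpos n).le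
    linarith
  have hw : 0 < ω.real (Set.Ico (3 / 4) 1) := by
    obtain ⟨n, -, hn⟩ := key (1 / 2) le_rfl (by norm_num)
    have := (hpos n).trans_le hn
    rw [show ((1 : ℝ) + 1 / 2) / 2 = 3 / 4 by norm_num] at this
    exact pos_of_mul_pos_right this (by positivity)
  -- The first term of the constant serves `r ≥ 1/2`; the second serves `r < 1/2`, where the smaller
  -- tail contains `[3/4, 1)`.
  refine ⟨inferInstance, ?_, 4 * C ^ j + ω.real Set.univ / ω.real (Set.Ico (3 / 4) 1),
    by positivity, fun r hr hr1 => ?_⟩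
  · refine measure_mono_null (t := (Set.Icc (0 : ℝ) 1)ᶜ ∪ {1}) ?_ (measure_union_null hsupp hone)
    intro x hx
    by_cases h : x = 1
    · exact Or.inr h
    · exact Or.inl fun hx' => hx ⟨hx'.1, lt_of_le_of_ne hx'.2 h⟩
  · rw [add_mul]
    have hW : 0 ≤ ω.real (Set.Ico ((1 + r) / 2) 1) := measureReal_nonneg
    rcases le_or_gt (1 / 2) r with h | h
    · obtain ⟨n, hn1, hn⟩ := key r h hr1
      have h1 := pow_mul_measureReal_Ico_le_radialMoment ω n hr
      -- Bernoulli's inequality, with `n (1 - r) ≤ 1/2`.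
      have h2 : 1 / 2 ≤ r ^ n := by
        have := one_add_mul_le_pow (a := r - 1) (by linarith) n
        rw [add_sub_cancel] at this
        linarith
      have h3 : 1 / 2 * ω.real (Set.Ico r 1) ≤ r ^ n * ω.real (Set.Ico r 1) := by gcongr
      have h4 : 0 ≤ ω.real Set.univ / ω.real (Set.Ico (3 / 4) 1)
          * ω.real (Set.Ico ((1 + r) / 2) 1) := by positivity
      linarith
    · have h1 : ω.real (Set.Ico (3 / 4) 1) ≤ ω.real (Set.Ico ((1 + r) / 2) 1) :=
        measureReal_mono (Set.Ico_subset_Ico_left (by linarith))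
      have h2 : ω.real (Set.Ico r 1) ≤ ω.real Set.univ := measureReal_mono (Set.subset_univ _)
      have h3 : ω.real Set.univ ≤ ω.real Set.univ / ω.real (Set.Ico (3 / 4) 1)
          * ω.real (Set.Ico ((1 + r) / 2) 1) := by
        rw [div_mul_eq_mul_div, le_div_iff₀ hw]
        gcongr
      have h4 : 0 ≤ 4 * C ^ j * ω.real (Set.Ico ((1 + r) / 2) 1) := by positivity
      linarith

end Doubling

/-! ### Power series and the kernel of `A²_ω`. -/

section Bergman
open MeasureTheory Filter Topology RadialBergman

lemma summable_norm_coeff_of_hasSum {c : ℕ → ℂ} {f : ℂ → ℂ}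
    (h : ∀ z ∈ Metric.ball (0 : ℂ) 1, HasSum (fun n : ℕ => c n * z ^ n) (f z))
    {r : ℝ} (hr : 0 ≤ r) (hr1 : r < 1) : Summable fun n : ℕ => ‖c n‖ * r ^ n := by
  have := (h (r : ℂ) (by simpa [abs_of_nonneg hr] using hr1)).summable.norm
  simpa [abs_of_nonneg hr] using this

lemma analyticOnNhd_of_hasSum {c : ℕ → ℂ} {f : ℂ → ℂ}
    (h : ∀ z ∈ Metric.ball (0 : ℂ) 1, HasSum (fun n : ℕ => c n * z ^ n) (f z)) :
    AnalyticOnNhd ℂ f (Metric.ball 0 1) := by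
  have hp : HasFPowerSeriesOnBall f (FormalMultilinearSeries.ofScalars ℂ c) 0 1 := by
    refine ⟨?_, one_pos, fun {y} hy => ?_⟩
    · refine ENNReal.le_of_forall_nnreal_lt fun r hr => ?_
      refine FormalMultilinearSeries.le_radius_of_summable _ ?_
      have hr1 : (r : ℝ) < 1 := by exact_mod_cast hr
      simpa [FormalMultilinearSeries.ofScalars_norm] using
        summable_norm_coeff_of_hasSum h r.2 hr1
    · have hy' : y ∈ Metric.ball (0 : ℂ) 1 := by
        simpa [← Metric.eball_ofReal] using hy
      simpa [FormalMultilinearSeries.ofScalars_apply_eq, smul_eq_mul, mul_comm] using h y hy'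
  have := hp.analyticOnNhd
  rwa [← ENNReal.ofReal_one, Metric.eball_ofReal] at this

lemma exists_hasSum_of_analyticOnNhd {f : ℂ → ℂ} (hf : AnalyticOnNhd ℂ f (Metric.ball 0 1)) :
    ∃ c : ℕ → ℂ, ∀ z ∈ Metric.ball (0 : ℂ) 1, HasSum (fun n : ℕ => c n * z ^ n) (f z) := by
  refine ⟨fun n => (n.factorial : ℂ)⁻¹ * iteratedDeriv n f 0, fun z hz => ?_⟩
  have := Complex.hasSum_taylorSeries_on_ball (r := 1) (c := 0) (f := f)
    hf.differentiableOn (by simpa using hz)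
  have e : (fun n : ℕ => (n.factorial : ℂ)⁻¹ * iteratedDeriv n f 0 * z ^ n)
      = fun n : ℕ => (n.factorial : ℂ)⁻¹ • (z - 0) ^ n • iteratedDeriv n f 0 := by
    funext n
    rw [sub_zero, smul_eq_mul, smul_eq_mul]
    ring
  rw [e]
  exact this

lemma integral_exp_int_mul_I (l : ℤ) (hl : l ≠ 0) :
    ∫ θ in Set.Ioc (-Real.pi) Real.pi, Complex.exp ((l * Complex.I) * (θ : ℂ)) = 0 := by
  have hc : (l * Complex.I : ℂ) ≠ 0 := by simp [hl]
  rw [← intervalIntegral.integral_of_le (by linarith [Real.pi_pos]), integral_exp_mul_complex hc]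
  have : Complex.exp (l * Complex.I * (Real.pi : ℝ))
      = Complex.exp (l * Complex.I * ((-Real.pi : ℝ) : ℂ)) := by
    rw [Complex.exp_eq_exp_iff_exists_int]
    exact ⟨l, by push_cast; ring⟩
  rw [this, sub_self, zero_div]

lemma polar_norm {r : ℝ} (hr : 0 ≤ r) (θ : ℝ) :
    ‖(r : ℂ) * Complex.exp ((θ : ℂ) * Complex.I)‖ = r := by
  rw [norm_mul, Complex.norm_exp_ofReal_mul_I, mul_one, Complex.norm_real, Real.norm_of_nonneg hr]

/-- Absolute convergence on the circle of radius `r < 1` permits termwise integration; orthogonality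
of characters leaves only `k = n`. -/
lemma integral_circle_mul_conj_pow {c : ℕ → ℂ} {f : ℂ → ℂ}
    (h : ∀ z ∈ Metric.ball (0 : ℂ) 1, HasSum (fun n : ℕ => c n * z ^ n) (f z))
    {r : ℝ} (hr : 0 ≤ r) (hr1 : r < 1) (n : ℕ) :
    ∫ θ in Set.Ioc (-Real.pi) Real.pi, f (r * Complex.exp (θ * Complex.I))
        * conj ((r : ℂ) * Complex.exp (θ * Complex.I)) ^ n
      = 2 * Real.pi * c n * r ^ (2 * n) := by
  set F : ℕ → ℝ → ℂ := fun k θ =>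
    (c k * ((r : ℂ) * Complex.exp (θ * Complex.I)) ^ k)
      * conj ((r : ℂ) * Complex.exp (θ * Complex.I)) ^ n
  have hcont : ∀ k, Continuous (F k) := fun k => by
    have : Continuous fun θ : ℝ => conj ((r : ℂ) * Complex.exp (θ * Complex.I)) :=
      Complex.continuous_conj.comp (by fun_prop)
    fun_prop
  have hint : ∀ k, Integrable (F k) (volume.restrict (Set.Ioc (-Real.pi) Real.pi)) := fun k =>
    (hcont k).integrableOn_Ioc
  have hnorm : ∀ k θ, ‖F k θ‖ = ‖c k‖ * r ^ k * r ^ n := fun k θ => by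
    simp only [F]
    rw [norm_mul, norm_mul, norm_pow, norm_pow, RCLike.norm_conj, polar_norm hr]
  have hsum := hasSum_integral_of_summable_integral_norm hint (by
    simp only [hnorm, integral_const, smul_eq_mul]
    exact ((summable_norm_coeff_of_hasSum h hr hr1).mul_right _).mul_left _)
  have htsum : ∀ θ : ℝ, ∑' k, F k θ = f (r * Complex.exp (θ * Complex.I))
        * conj ((r : ℂ) * Complex.exp (θ * Complex.I)) ^ n := fun θ =>
    ((h _ (by rw [mem_ball_zero_iff, polar_norm hr]; exact hr1)).mul_right _).tsum_eq
  simp only [htsum] at hsum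
  have hF : ∀ k θ, F k θ
      = c k * r ^ k * r ^ n * Complex.exp ((((k : ℤ) - (n : ℤ) : ℤ) * Complex.I) * (θ : ℂ)) := by
    intro k θ
    have : conj ((r : ℂ) * Complex.exp (θ * Complex.I))
        = r * Complex.exp (-(θ * Complex.I)) := by
      rw [map_mul, Complex.conj_ofReal, ← Complex.exp_conj]
      simp
    simp only [F]
    rw [this, mul_pow, mul_pow, ← Complex.exp_nat_mul, ← Complex.exp_nat_mul]
    have e : Complex.exp ((((k : ℤ) - (n : ℤ) : ℤ) * Complex.I) * (θ : ℂ))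
        = Complex.exp (k * (θ * Complex.I)) * Complex.exp (n * (-(θ * Complex.I))) := by
      rw [← Complex.exp_add]; congr 1; push_cast; ring
    rw [e]; ring
  have hI : ∀ k, k ≠ n → ∫ θ in Set.Ioc (-Real.pi) Real.pi, F k θ = 0 := by
    intro k hk
    simp only [hF]
    rw [integral_const_mul, integral_exp_int_mul_I _ (by omega), mul_zero]
  have hn : ∫ θ in Set.Ioc (-Real.pi) Real.pi, F n θ = 2 * Real.pi * c n * r ^ (2 * n) := by
    simp only [hF]
    simp only [sub_self, Int.cast_zero, zero_mul, Complex.exp_zero, mul_one, integral_const,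
      Measure.real, Measure.restrict_apply_univ, Real.volume_Ioc]
    rw [ENNReal.toReal_ofReal (by linarith [Real.pi_pos]), Complex.real_smul]
    push_cast
    ring
  rw [← hn]
  exact hsum.unique (hasSum_single n hI)

variable {ω : Measure ℝ}

lemma ae_mem_Ico (hsupp : ω (Set.Ico (0 : ℝ) 1)ᶜ = 0) : ∀ᵐ r ∂ω, r ∈ Set.Ico (0 : ℝ) 1 := by
  rw [ae_iff]; exact hsupp

lemma isFiniteMeasure_withDensity_ofReal_id [IsFiniteMeasure ω]
    (hsupp : ω (Set.Ico (0 : ℝ) 1)ᶜ = 0) :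
    IsFiniteMeasure (ω.withDensity fun r => ENNReal.ofReal r) := by
  refine isFiniteMeasure_withDensity (ne_of_lt ?_)
  calc ∫⁻ r, ENNReal.ofReal r ∂ω ≤ ∫⁻ _, 1 ∂ω := by
        refine lintegral_mono_ae ?_
        filter_upwards [ae_mem_Ico hsupp] with r hr
        simpa using hr.2.le
    _ < ⊤ := by simp

lemma isFiniteMeasure_polarMeasure [IsFiniteMeasure ω] (hsupp : ω (Set.Ico (0 : ℝ) 1)ᶜ = 0) :
    IsFiniteMeasure (polarMeasure ω) := by
  have := isFiniteMeasure_withDensity_ofReal_id hsupp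
  have : IsFiniteMeasure (ENNReal.ofReal (Real.pi⁻¹) •
        (volume : Measure ℝ).restrict (Set.Ioc (-Real.pi) Real.pi)) :=
    Measure.smul_finite _ ENNReal.ofReal_ne_top
  rw [polarMeasure]
  infer_instance

lemma integral_ball_polarMeasure [IsFiniteMeasure ω] (hsupp : ω (Set.Ico (0 : ℝ) 1)ᶜ = 0)
    {g : ℂ → ℂ} (hg : IntegrableOn g (Metric.ball 0 1) (polarMeasure ω)) :
    ∫ ζ in Metric.ball (0 : ℂ) 1, g ζ ∂(polarMeasure ω)
      = ∫ r in Set.Icc (0 : ℝ) 1, (r : ℂ) * ((Real.pi⁻¹ : ℝ) * ∫ θ in Set.Ioc (-Real.pi) Real.pi,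
          g (r * Complex.exp (θ * Complex.I))) ∂ω := by
  have := isFiniteMeasure_withDensity_ofReal_id hsupp
  have hG : Integrable ((Metric.ball (0 : ℂ) 1).indicator g) (polarMeasure ω) :=
    (integrable_indicator_iff Metric.isOpen_ball.measurableSet).mpr hg
  have hmeas : Measurable fun p : ℝ × ℝ => (p.1 : ℂ) * Complex.exp ((p.2 : ℂ) * Complex.I) :=
    Continuous.measurable (by fun_prop)
  rw [← integral_indicator Metric.isOpen_ball.measurableSet]
  have hG2 := hG
  rw [polarMeasure] at hG2 ⊢
  rw [integrable_map_measure hG2.aestronglyMeasurable hmeas.aemeasurable] at hG2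
  rw [integral_map hmeas.aemeasurable hG.aestronglyMeasurable]
  rw [integral_prod (fun p : ℝ × ℝ =>
      (Metric.ball (0 : ℂ) 1).indicator g ((p.1 : ℂ) * Complex.exp ((p.2 : ℂ) * Complex.I))) hG2,
    integral_withDensity_eq_integral_toReal_smul (by fun_prop) (by simp),
    Measure.restrict_eq_self_of_ae_mem (μ := ω) (by
      filter_upwards [ae_mem_Ico hsupp] with r hr using ⟨hr.1, hr.2.le⟩)]
  refine integral_congr_ae ?_
  filter_upwards [ae_mem_Ico hsupp] with r hr
  have hin : ∀ θ : ℝ, (Metric.ball (0 : ℂ) 1).indicator g (r * Complex.exp (θ * Complex.I))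
      = g (r * Complex.exp (θ * Complex.I)) := fun θ =>
    Set.indicator_of_mem (by rw [mem_ball_zero_iff, polar_norm hr.1]; exact hr.2) _
  simp only [hin]
  rw [integral_smul_measure, ENNReal.toReal_ofReal hr.1,
    ENNReal.toReal_ofReal (inv_nonneg.mpr Real.pi_pos.le), Complex.real_smul, Complex.real_smul]

/-- The measure is finite and `x ≤ 1 + x ^ 2`. -/
lemma integrableOn_of_memBergmanTwo [IsFiniteMeasure ω] (hsupp : ω (Set.Ico (0 : ℝ) 1)ᶜ = 0)
    {f : ℂ → ℂ} (hf : MemBergmanTwo ω f) :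
    IntegrableOn f (Metric.ball 0 1) (polarMeasure ω) := by
  have := isFiniteMeasure_polarMeasure hsupp
  refine ⟨hf.1.continuousOn.aestronglyMeasurable Metric.isOpen_ball.measurableSet, ?_⟩
  have hle : ∀ x : ENNReal, x ≤ 1 + x ^ 2 := by
    intro x
    rcases le_total x 1 with h | h
    · exact h.trans le_self_add
    · calc x = x * 1 := (mul_one x).symm
        _ ≤ x * x := by gcongr
        _ = x ^ 2 := (sq x).symm
        _ ≤ 1 + x ^ 2 := le_add_self
  calc ∫⁻ ζ in Metric.ball (0 : ℂ) 1, ‖f ζ‖ₑ ∂(polarMeasure ω)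
      ≤ ∫⁻ ζ in Metric.ball (0 : ℂ) 1, (1 + ‖f ζ‖ₑ ^ 2) ∂(polarMeasure ω) :=
        lintegral_mono fun ζ => hle _
    _ = ∫⁻ ζ in Metric.ball (0 : ℂ) 1, 1 ∂(polarMeasure ω)
        + ∫⁻ ζ in Metric.ball (0 : ℂ) 1, ‖f ζ‖ₑ ^ 2 ∂(polarMeasure ω) :=
        lintegral_add_left measurable_const _
    _ < ⊤ := ENNReal.add_lt_top.mpr ⟨by simp, hf.2⟩

lemma memBergmanTwo_of_bounded [IsFiniteMeasure ω] (hsupp : ω (Set.Ico (0 : ℝ) 1)ᶜ = 0)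
    {f : ℂ → ℂ} (hf : AnalyticOnNhd ℂ f (Metric.ball 0 1)) {S : ℝ}
    (hS : ∀ ζ ∈ Metric.ball (0 : ℂ) 1, ‖f ζ‖ ≤ S) : MemBergmanTwo ω f := by
  have := isFiniteMeasure_polarMeasure hsupp
  refine ⟨hf, ?_⟩
  calc ∫⁻ ζ in Metric.ball (0 : ℂ) 1, ‖f ζ‖ₑ ^ 2 ∂(polarMeasure ω)
      ≤ ∫⁻ _ in Metric.ball (0 : ℂ) 1, ENNReal.ofReal S ^ 2 ∂(polarMeasure ω) := by
        refine setLIntegral_mono' Metric.isOpen_ball.measurableSet fun ζ hζ => ?_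
        gcongr
        rw [← ofReal_norm]
        exact ENNReal.ofReal_le_ofReal (hS ζ hζ)
    _ < ⊤ := by
        rw [lintegral_const]
        exact ENNReal.mul_lt_top (by finiteness) (by simp)

lemma integrableOn_mul_conj_pow [IsFiniteMeasure ω] (hsupp : ω (Set.Ico (0 : ℝ) 1)ᶜ = 0)
    {f : ℂ → ℂ} (hf : MemBergmanTwo ω f) (n : ℕ) :
    IntegrableOn (fun ζ => f ζ * conj ζ ^ n) (Metric.ball 0 1) (polarMeasure ω) := by
  refine (integrableOn_of_memBergmanTwo hsupp hf).mul_bdd (c := 1)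
    (Complex.continuous_conj.pow n).aestronglyMeasurable ?_
  filter_upwards [ae_restrict_mem Metric.isOpen_ball.measurableSet] with ζ hζ
  rw [norm_pow, RCLike.norm_conj]
  exact pow_le_one₀ (norm_nonneg _) (mem_ball_zero_iff.mp hζ).le

/-- The pairing of an element of `A²_ω` with a monomial. -/
lemma integral_mul_conj_pow [IsFiniteMeasure ω] (hsupp : ω (Set.Ico (0 : ℝ) 1)ᶜ = 0)
    {f : ℂ → ℂ} (hf : MemBergmanTwo ω f) {c : ℕ → ℂ}
    (h : ∀ z ∈ Metric.ball (0 : ℂ) 1, HasSum (fun n : ℕ => c n * z ^ n) (f z)) (n : ℕ) :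
    ∫ ζ in Metric.ball (0 : ℂ) 1, f ζ * conj ζ ^ n ∂(polarMeasure ω)
      = c n * (2 * (radialMoment ω (2 * n + 1) : ℂ)) := by
  rw [integral_ball_polarMeasure hsupp (integrableOn_mul_conj_pow hsupp hf n), radialMoment,
    ← integral_complex_ofReal, ← integral_const_mul, ← integral_const_mul]
  refine integral_congr_ae ?_
  filter_upwards [ae_restrict_of_ae (ae_mem_Ico hsupp)] with r hr
  rw [integral_circle_mul_conj_pow h hr.1 hr.2]
  have : (Real.pi : ℂ) ≠ 0 := by exact_mod_cast Real.pi_ne_zero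
  push_cast
  field_simp
  ring

/-- The Bergman kernel of `A²_ω` is given by its power series. -/
theorem isBergmanKernel_of_hasSum [IsFiniteMeasure ω] (hsupp : ω (Set.Ico (0 : ℝ) 1)ᶜ = 0)
    (hpos : ∀ k : ℕ, 0 < radialMoment ω (2 * k + 1)) {g : ℂ → ℂ}
    (hg : ∀ z ∈ Metric.ball (0 : ℂ) 1,
      HasSum (fun k : ℕ => z ^ k / (2 * (radialMoment ω (2 * k + 1) : ℂ))) (g z)) :
    IsBergmanKernel ω (fun z ζ => g (conj z * ζ)) := by
  intro z hz
  have hz1 : ‖z‖ < 1 := mem_ball_zero_iff.mp hz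
  set m : ℕ → ℂ := fun k => 2 * (radialMoment ω (2 * k + 1) : ℂ)
  have hm : ∀ k, m k ≠ 0 := fun k => by
    have : (radialMoment ω (2 * k + 1) : ℂ) ≠ 0 := by exact_mod_cast (hpos k).ne'
    exact mul_ne_zero two_ne_zero this
  have hmconj : ∀ k, conj (m k) = m k := fun k => by
    simp only [m, map_mul, Complex.conj_ofReal, map_ofNat]
  set b : ℕ → ℂ := fun k => conj z ^ k / m k
  -- Absolute convergence of the series of `g` at `z` itself. It bounds the kernel on the whole disc
  -- and justifies the termwise pairing below.
  have hbsum : Summable fun k => ‖b k‖ := by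
    have := (hg z hz).summable.norm
    simpa [b, m] using this
  have hB : ∀ ζ ∈ Metric.ball (0 : ℂ) 1, HasSum (fun k => b k * ζ ^ k) (g (conj z * ζ)) := by
    intro ζ hζ
    have hζ1 : ‖ζ‖ < 1 := mem_ball_zero_iff.mp hζ
    have hmem : conj z * ζ ∈ Metric.ball (0 : ℂ) 1 := by
      rw [mem_ball_zero_iff, norm_mul, RCLike.norm_conj]
      exact mul_lt_one_of_nonneg_of_lt_one_left (norm_nonneg _) hz1 hζ1.le
    convert hg _ hmem using 2 with k
    simp only [b, m]
    rw [mul_pow, div_mul_eq_mul_div]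
  have hBmem : MemBergmanTwo ω fun ζ => g (conj z * ζ) := by
    refine memBergmanTwo_of_bounded hsupp (analyticOnNhd_of_hasSum hB) (S := ∑' k, ‖b k‖)
      fun ζ hζ => ?_
    rw [← (hB ζ hζ).tsum_eq]
    refine tsum_of_norm_bounded hbsum.hasSum fun k => ?_
    rw [norm_mul, norm_pow]
    exact mul_le_of_le_one_right (norm_nonneg _)
      (pow_le_one₀ (norm_nonneg _) (mem_ball_zero_iff.mp hζ).le)
  refine ⟨⟨hBmem, fun f hf => ?_⟩, fun K hK => ?_⟩
  · obtain ⟨c, hc⟩ := exists_hasSum_of_analyticOnNhd hf.1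
    have hfi := integrableOn_of_memBergmanTwo hsupp hf
    set G : ℕ → ℂ → ℂ := fun k ζ => conj (b k) * (f ζ * conj ζ ^ k)
    have hGi : ∀ k, Integrable (G k) ((polarMeasure ω).restrict (Metric.ball 0 1)) := fun k =>
      (integrableOn_mul_conj_pow hsupp hf k).const_mul _
    have hsum := hasSum_integral_of_summable_integral_norm hGi (by
      refine Summable.of_nonneg_of_le (fun k => integral_nonneg fun _ => norm_nonneg _)
        (fun k => ?_) (hbsum.mul_right (∫ ζ in Metric.ball (0 : ℂ) 1, ‖f ζ‖ ∂(polarMeasure ω)))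
      rw [← integral_const_mul]
      refine setIntegral_mono_on (hGi k).norm (hfi.norm.const_mul _)
        Metric.isOpen_ball.measurableSet fun ζ hζ => ?_
      simp only [G, norm_mul, norm_pow, RCLike.norm_conj]
      gcongr
      exact mul_le_of_le_one_right (norm_nonneg _)
        (pow_le_one₀ (norm_nonneg _) (mem_ball_zero_iff.mp hζ).le))
    have hG : ∫ ζ in Metric.ball (0 : ℂ) 1, ∑' k, G k ζ ∂(polarMeasure ω)
        = ∫ ζ in Metric.ball (0 : ℂ) 1, f ζ * conj (g (conj z * ζ)) ∂(polarMeasure ω) := by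
      refine setIntegral_congr_fun Metric.isOpen_ball.measurableSet fun ζ hζ => ?_
      have h1 := ((Complex.hasSum_conj'.mpr (hB ζ hζ))).mul_left (f ζ)
      refine Eq.trans (tsum_congr fun k => ?_) h1.tsum_eq
      simp only [G, map_mul, map_pow]
      ring
    rw [hG] at hsum
    refine ((hc z hz).unique ?_)
    have hterm : (fun k => c k * z ^ k)
        = fun k => ∫ ζ in Metric.ball (0 : ℂ) 1, G k ζ ∂(polarMeasure ω) := by
      funext k
      simp only [G]
      rw [integral_const_mul, integral_mul_conj_pow hsupp hf hc k]
      simp only [b, map_div₀, map_pow, Complex.conj_conj, hmconj]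
      change _ = z ^ k / m k * (c k * m k)
      field_simp [hm k]
    rw [hterm]
    exact hsum
  · obtain ⟨κ, hκ⟩ := exists_hasSum_of_analyticOnNhd hK.1.1
    -- Reproducing the monomial `ζ ^ k` forces the `k`-th Taylor coefficient of `K`.
    have hcoef : ∀ k, κ k = b k := by
      intro k
      have hmono : MemBergmanTwo ω fun ζ => ζ ^ k :=
        memBergmanTwo_of_bounded hsupp (S := 1) (fun ζ _ => by fun_prop) fun ζ hζ => by
          rw [norm_pow]
          exact pow_le_one₀ (norm_nonneg _) (mem_ball_zero_iff.mp hζ).le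
      have h1 := hK.2 _ hmono
      have h2 := integral_mul_conj_pow hsupp hK.1 hκ k
      have h3 : conj (z ^ k) = κ k * m k := by
        rw [h1, ← integral_conj, ← h2]
        refine integral_congr_ae (Eventually.of_forall fun ζ => ?_)
        simp [mul_comm]
      simp only [b]
      rw [eq_div_iff (hm k), ← h3, map_pow]
    intro ζ hζ
    have h1 := hκ ζ hζ
    simp only [hcoef] at h1
    exact h1.unique (hB ζ hζ)

end Bergman

/-! ### Partial sums and the main theorem. -/

/-- Dividing a power series by `1 - z` replaces the coefficients by their partial sums. -/
lemma hasSum_partialSum_mul_pow {c : ℕ → ℂ} {f : ℂ → ℂ}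
    (h : ∀ z ∈ Metric.ball (0 : ℂ) 1, HasSum (fun n : ℕ => c n * z ^ n) (f z))
    {z : ℂ} (hz : z ∈ Metric.ball (0 : ℂ) 1) :
    HasSum (fun n : ℕ => (∑ j ∈ Finset.range (n + 1), c j) * z ^ n) (f z / (1 - z)) := by
  have hz1 : ‖z‖ < 1 := mem_ball_zero_iff.mp hz
  have h1 := hasSum_sum_range_mul_of_summable_norm (h z hz).summable.norm
    (summable_norm_geometric_of_norm_lt_one hz1)
  rw [(h z hz).tsum_eq, tsum_geometric_of_norm_lt_one hz1, ← div_eq_mul_inv] at h1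
  have e : (fun n : ℕ => (∑ j ∈ Finset.range (n + 1), c j) * z ^ n)
      = fun n : ℕ => ∑ k ∈ Finset.range (n + 1), c k * z ^ k * z ^ (n - k) := by
    funext n
    rw [Finset.sum_mul]
    refine Finset.sum_congr rfl fun j hj => ?_
    have : j ≤ n := by simpa [Nat.lt_succ_iff] using hj
    rw [mul_assoc, ← pow_add, Nat.add_sub_cancel' this]
  rw [e]
  exact h1

theorem theorem5
    (F : ℝ → ℝ) (hFpos : ∀ x : ℝ, 0 ≤ x → 0 < F x)
    (hFsmooth : ContDiffOn ℝ (⊤ : ℕ∞) F (Set.Ici 0))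
    (hFcm : RadialBergman.CompletelyMonotonic (fun x => 1 / F x))
    (φ : ℂ → ℂ) (φhat : ℕ → ℂ)
    (hφ : ∀ z ∈ Metric.ball (0 : ℂ) 1, HasSum (fun n : ℕ => φhat n * z ^ n) (φ z))
    (a : ℝ) (ha : 0 < a)
    (hFφ : ∀ n : ℕ, ((F (a + 2 * n + 1) : ℝ) : ℂ) = ∑ j ∈ Finset.range (n + 1), φhat j) :
    ∃ ω : MeasureTheory.Measure ℝ,
      MeasureTheory.IsFiniteMeasure ω ∧
      ω (Set.Icc (0 : ℝ) 1)ᶜ = 0 ∧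
      (∀ k : ℕ, 0 < RadialBergman.radialMoment ω (2 * k + 1)) ∧
      (∀ z ∈ Metric.ball (0 : ℂ) 1,
        HasSum (fun k : ℕ => z ^ k / (2 * (RadialBergman.radialMoment ω (2 * k + 1) : ℂ)))
          (φ z / (1 - z))) ∧
      (Filter.Tendsto (fun n : ℕ => F (a + 2 * n + 1)) Filter.atTop Filter.atTop →
        (∃ C : ℝ, 0 < C ∧ ∀ n : ℕ, F (a + 2 * n) ≤ C * F (a + n)) →
        (∃ M : ℝ, 1 < M ∧
          Filter.Tendsto (fun n : ℕ => M ^ n / F (a + n)) Filter.atTop Filter.atTop) →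
        RadialBergman.IsDoubling ω ∧
          RadialBergman.IsBergmanKernel ω
            (fun z ζ => φ (conj z * ζ) / (1 - conj z * ζ))) := by
  -- The factor `1 / 2` makes `1 / (2 ω_{2k+1})` equal to `F(a + 2k + 1)`.
  set s : ℕ → ℝ := fun n => 1 / 2 * (1 / F (a + n))
  have hFn : ∀ n : ℕ, 0 < F (a + n) := fun n => hFpos _ (by positivity)
  have hspos : ∀ n, 0 < s n := fun n => by
    have := hFn n
    positivity
  have hdiff : ∀ j n, altDiff s j n = 1 / 2 * altDiff (fun n : ℕ => 1 / F (a + n)) j n := by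
    intro j
    induction j with
    | zero => intro n; rfl
    | succ j ih => intro n; simp only [altDiff, ih]; ring
  obtain ⟨ω, hfin, hsupp, hmom⟩ := exists_measure_radialMoment (s := s)
    (fun j n => by
      rw [hdiff]
      exact mul_nonneg (by norm_num) (hFcm.altDiff_nonneg ha j n)) (hspos 0)
  have hpos : ∀ n, 0 < RadialBergman.radialMoment ω n := fun n => by
    rw [hmom]; exact hspos n
  have hodd : ∀ k : ℕ, RadialBergman.radialMoment ω (2 * k + 1)
      = 1 / 2 * (1 / F (a + 2 * k + 1)) := fun k => by
    rw [hmom]; simp only [s]; push_cast; rw [add_assoc]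
  have hseries : ∀ z ∈ Metric.ball (0 : ℂ) 1,
      HasSum (fun k : ℕ => z ^ k / (2 * (RadialBergman.radialMoment ω (2 * k + 1) : ℂ)))
        (φ z / (1 - z)) := by
    intro z hz
    convert hasSum_partialSum_mul_pow hφ hz using 1
    funext k
    rw [← hFφ, hodd]
    push_cast
    simp [div_eq_mul_inv, mul_comm]
  refine ⟨ω, hfin, hsupp, fun k => hpos _, hseries, fun hlim ⟨C, hC, hCF⟩ _ => ?_⟩
  have hdoubling : RadialBergman.IsDoubling ω := by
    refine isDoubling_of_radialMoment_le hsupp hpos ?_ hC fun n => ?_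
    · simp only [hodd]
      have := (hlim.inv_tendsto_atTop).const_mul (1 / 2 : ℝ)
      simpa using this
    -- Taking reciprocals in `F(a + 2n) ≤ C F(a + n)` gives `ω_n ≤ C ω_{2n}` with the same `C`.
    · rw [hmom, hmom]
      simp only [s]
      push_cast
      have h1 := hFn n
      have h2 : 0 < F (a + 2 * n) := hFpos _ (by positivity)
      have h3 : 1 / F (a + n) ≤ C * (1 / F (a + 2 * n)) := by
        rw [mul_one_div, div_le_div_iff₀ h1 h2, one_mul]
        exact hCF n
      linarith
  exact ⟨hdoubling, isBergmanKernel_of_hasSum hdoubling.supported (fun k => hpos _) hseries⟩
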